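/- For $1\le q\le\infty$ and $n\in\mathbb N$, let $\mathbb B_q^n=\{x\in\mathbb R^n:\|x\|_q\le 1\}$, where $\|x\|_q=(\sum_{i=1}^n|x_i|^q)^{1/q}$ for $q<\infty$ and $\|x\|_\infty=\max_i|x_i|$, and let $q^*\in[1,\infty]$ be the conjugate exponent, $\frac1q+\frac1{q^*}=1$ (with $\frac1\infty=0$). For each $n\ge 1$ let $\theta=\theta_n$ be a random vector distributed according to the normalized surface measure on the Euclidean unit sphere $\mathbb S^{n-1}\subset\mathbb R^n$, and let $\mathrm{vol}_1(P_\theta\mathbb B_q^n)$ be the length of the orthogonal projection of $\mathbb B_q^n$ onto the line spanned by $\theta$. For real $r\ge 0$ put $$M_2(r)=\frac{2^{r/2}}{r+1}\,\frac{\Gamma\left(1+\frac{r+1}{2}\right)}{\Gamma\left(1+\frac12\right)} .$$ (a) If $1<q\le\infty$ and $q\ne 2$, then $$\sigma_q^2:=\frac{1}{(q^*)^2}\left(\sqrt\pi\,\frac{\Gamma\left(\frac{2q^*+1}{2}\right)}{\Gamma\left(\frac{q^*+1}{2}\right)^2}-1\right)-\frac12\ \ge\ 0,$$ and, as $n\to\infty$,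 $$\frac{n^{1/q}\,\mathrm{vol}_1(P_\theta\mathbb B_q^n)}{2M_2(q^*)^{1/q^*}}-\sqrt n$$ converges in distribution to a centered Gaussian random variable with variance $\sigma_q^2$. (b) If $q=1$, then, as $n\to\infty$, $$\sqrt{2n\log n}\;\mathrm{vol}_1(P_\theta\mathbb B_1^n)-2A_n^{(2)}$$ converges in distribution to $2G$, where $G$ is a Gumbel random variable with distribution function $F_G(t)=e^{-e^{-t}}$, $t\in\mathbb R$, and $$A_n^{(2)}=2\log n+\frac12\left(-\log(2\log n)+2\log K\right),\qquad K=\frac{1}{\sqrt2\,\Gamma\left(1+\frac12\right)} .$$ -/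

import Mathlib

open MeasureTheory ProbabilityTheory Filter Set Topology
open scoped ENNReal NNReal

noncomputable section

/-- The unit ball of the `ℓ_q`-norm in `ℝ^n`, for `1 ≤ q ≤ ∞`, as a subset of Euclidean space:
the norm of `WithLp.toLp q x` is `(∑ |x i| ^ q) ^ (1 / q)` for `q < ∞` and `max |x i|` for
`q = ∞`. -/
def lqBall (n : ℕ) (q : ℝ≥0∞) : Set (EuclideanSpace ℝ (Fin n)) :=
  {x | ‖(WithLp.toLp q x.ofLp : PiLp q (fun _ : Fin n => ℝ))‖ ≤ 1}

/-- The length (one-dimensional Hausdorff measure) of the orthogonal projection of `K` onto the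
line spanned by `v`. -/
def projLength {n : ℕ} (v : EuclideanSpace ℝ (Fin n)) (K : Set (EuclideanSpace ℝ (Fin n))) : ℝ :=
  (μH[1] ((ℝ ∙ v).starProjection '' K)).toReal

/-- The normalized surface measure on the Euclidean unit sphere of `ℝ^n`
(a probability measure for `n ≥ 1`). -/
def uniformSphere (n : ℕ) : Measure (Metric.sphere (0 : EuclideanSpace ℝ (Fin n)) 1) :=
  ((volume : Measure (EuclideanSpace ℝ (Fin n))).toSphere univ)⁻¹ •
    (volume : Measure (EuclideanSpace ℝ (Fin n))).toSphere

/-- The constant `M_p(r)`, for real `p ≥ 1`. -/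
def momentM (p r : ℝ) : ℝ :=
  p ^ (r / p) / (r + 1) * (Real.Gamma (1 + (r + 1) / p) / Real.Gamma (1 + 1 / p))

/-- The limiting variance, as a function of the (real) conjugate exponent `r = q*`. -/
def projVariance (r : ℝ) : ℝ :=
  1 / r ^ 2 * (√Real.pi * (Real.Gamma ((2 * r + 1) / 2) / Real.Gamma ((r + 1) / 2) ^ 2) - 1) - 1 / 2

/-- The constant `K = 1 / (p^{1/p} Γ(1 + 1/p))`. -/
def gumbelK (p : ℝ) : ℝ := 1 / (p ^ (1 / p) * Real.Gamma (1 + 1 / p))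

/-- The centering sequence `A_n^{(p)} = p log n + ((1 - p) log (p log n) + p log K) / p`. -/
def centeringA (p : ℝ) (n : ℕ) : ℝ :=
  p * Real.log n + 1 / p * ((1 - p) * Real.log (p * Real.log n) + p * Real.log (gumbelK p))

/-- The Gumbel distribution function `t ↦ exp (-exp (-t))`. -/
def gumbelCDF : StieltjesFunction ℝ where
  toFun t := Real.exp (-Real.exp (-t))
  mono' := fun _ _ h =>
    Real.exp_le_exp.2 (neg_le_neg (Real.exp_le_exp.2 (neg_le_neg h)))
  right_continuous' := fun _ => Continuous.continuousWithinAt (by fun_prop)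

/-- The Gumbel distribution on `ℝ`. -/
def gumbelMeasure : Measure ℝ := gumbelCDF.measure

instance gumbelMeasure_isProbabilityMeasure : IsProbabilityMeasure gumbelMeasure := by
  refine gumbelCDF.isProbabilityMeasure ?_ ?_
  · exact Real.tendsto_exp_neg_atTop_nhds_zero.comp
      (Real.tendsto_exp_atTop.comp tendsto_neg_atBot_atTop)
  · have h : Tendsto (fun t : ℝ => Real.exp (-Real.exp (-t))) atTop (𝓝 (Real.exp (-0))) :=
      (Real.continuous_exp.tendsto _).comp Real.tendsto_exp_neg_atTop_nhds_zero.neg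
    rw [neg_zero, Real.exp_zero] at h
    exact h

end

/-! By Hölder duality the support function of `lqBall n q` is the ℓ_{q*}-norm, so its shadow on the
line through a unit vector θ is a segment of length 2‖θ‖_{q*} (`projLength_lqBall`). A uniform θ has
the law of g/‖g‖₂ with g standard Gaussian (`map_uniformSphere_eq_map_stdGaussian`). Convergence in
distribution depends only on laws, so it suffices to study 2‖g‖_{q*}/‖g‖₂, with the coordinates for
all n taken from a single iid sequence.

For q > 1, put r = q* < ∞ and let U, V be the empirical means of |g_i|^r / M₂(r) and g_i². The
normalized ratio is √n (U^{1/r} V^{-1/2} - 1). The delta method at (1, 1) replaces it by the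
centered and scaled sum of |g_i|^r / (r M₂(r)) - g_i²/2, to which the central limit theorem applies.
The variance of one summand is `projVariance r`, which is therefore nonnegative.

For q = 1 the numerator is max |g_i|. The Mills ratio makes n P(|g| > t_n) converge to e^{-y} at t_n
= (A_n + y)/√(2 log n), and independence then gives the Gumbel limit. Dividing by √V changes nothing
in the limit, because V^{-1/2} - 1 is of order n^{-1/2} in probability while A_n = O(log n). -/

/-! ### Duality of ℓ_q-norms and the length of projections -/

theorem isGreatest_dual_one {ι : Type*} [Fintype ι] [Nonempty ι] (v : ι → ℝ) :
    IsGreatest ((fun x : ι → ℝ => ∑ i, v i * x i) ''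
      {x | ‖(WithLp.toLp 1 x : PiLp 1 (fun _ : ι => ℝ))‖ ≤ 1})
      ‖(WithLp.toLp ∞ v : PiLp ∞ (fun _ : ι => ℝ))‖ := by
  classical
  simp only [PiLp.norm_eq_of_L1, PiLp.norm_eq_ciSup, Real.norm_eq_abs]
  have hbdd : BddAbove (range fun i => |v i|) := (finite_range _).bddAbove
  constructor
  · obtain ⟨j, hj⟩ := exists_eq_ciSup_of_finite (f := fun i => |v i|)
    refine ⟨Pi.single j (SignType.sign (v j) : ℝ), ?_, ?_⟩
    · have : ∀ i, |(Pi.single j (SignType.sign (v j) : ℝ) : ι → ℝ) i| ≤ if i = j then 1 else 0 := by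
        intro i
        rcases eq_or_ne i j with rfl | h
        · rcases lt_trichotomy (v i) 0 with h | h | h <;> simp [h]
        · simp [h]
      simpa using Finset.sum_le_sum (s := Finset.univ) fun i _ => this i
    · simp only [← hj]
      rw [Finset.sum_eq_single j (fun i _ h => by simp [h]) (by simp)]
      simp [self_mul_sign]
  · rintro _ ⟨x, hx, rfl⟩
    calc ∑ i, v i * x i ≤ ∑ i, (⨆ j, |v j|) * |x i| := Finset.sum_le_sum fun i _ =>
          (le_abs_self _).trans <| by
            rw [abs_mul]; exact mul_le_mul_of_nonneg_right (le_ciSup hbdd i) (abs_nonneg _)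
      _ = (⨆ j, |v j|) * ∑ i, |x i| := by rw [Finset.mul_sum]
      _ ≤ ⨆ j, |v j| := mul_le_of_le_one_right (Real.iSup_nonneg fun i => abs_nonneg _) hx

theorem isGreatest_dual_top {ι : Type*} [Fintype ι] [Nonempty ι] (v : ι → ℝ) :
    IsGreatest ((fun x : ι → ℝ => ∑ i, v i * x i) ''
      {x | ‖(WithLp.toLp ∞ x : PiLp ∞ (fun _ : ι => ℝ))‖ ≤ 1})
      ‖(WithLp.toLp 1 v : PiLp 1 (fun _ : ι => ℝ))‖ := by
  simp only [PiLp.norm_eq_of_L1, PiLp.norm_eq_ciSup, Real.norm_eq_abs]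
  constructor
  · refine ⟨fun i => (SignType.sign (v i) : ℝ), ?_, ?_⟩
    · change ⨆ i, |(SignType.sign (v i) : ℝ)| ≤ 1
      refine ciSup_le fun i => ?_
      rcases lt_trichotomy (v i) 0 with h | h | h <;> simp [h]
    · simp [self_mul_sign]
  · rintro _ ⟨x, hx, rfl⟩
    refine Finset.sum_le_sum fun i _ => (le_abs_self _).trans ?_
    rw [abs_mul]
    exact mul_le_of_le_one_right (abs_nonneg _)
      ((le_ciSup (f := fun i => |x i|) (finite_range _).bddAbove i).trans hx)

/-- The extremal vector for |v| is nonnegative; multiplying it by the signs of v gives one for v. -/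
theorem isGreatest_dual_of_ne_top {ι : Type*} [Fintype ι] {q qs : ℝ≥0∞}
    (hq : q.toReal.HolderConjugate qs.toReal) (v : ι → ℝ) :
    IsGreatest ((fun x : ι → ℝ => ∑ i, v i * x i) ''
      {x | ‖(WithLp.toLp q x : PiLp q (fun _ : ι => ℝ))‖ ≤ 1})
      ‖(WithLp.toLp qs v : PiLp qs (fun _ : ι => ℝ))‖ := by
  have h0 := hq.pos
  have h0' := hq.symm.pos
  have hiff : ∀ x : ι → ℝ, ‖(WithLp.toLp q x : PiLp q (fun _ : ι => ℝ))‖ ≤ 1 ↔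
      ∑ i, |x i| ^ q.toReal ≤ 1 := by
    intro x
    rw [PiLp.norm_eq_sum h0, one_div,
      Real.rpow_inv_le_iff_of_pos (by positivity) zero_le_one h0, Real.one_rpow]
    simp
  simp only [hiff, PiLp.norm_eq_sum h0', Real.norm_eq_abs]
  obtain ⟨⟨g, hg, hgv⟩, -⟩ := NNReal.isGreatest_Lp Finset.univ (fun i => ‖v i‖₊) hq.symm
  constructor
  · refine ⟨fun i => (SignType.sign (v i) : ℝ) * g i, ?_, ?_⟩
    · refine (Finset.sum_le_sum fun i _ => ?_).trans (show ∑ i, (g i : ℝ) ^ q.toReal ≤ 1 by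
        exact_mod_cast hg)
      refine Real.rpow_le_rpow (abs_nonneg _) ?_ h0.le
      rw [abs_mul, NNReal.abs_eq]
      refine mul_le_of_le_one_left (by positivity) ?_
      rcases lt_trichotomy (v i) 0 with h | h | h <;> simp [h]
    · have := congrArg ((↑) : ℝ≥0 → ℝ) hgv
      push_cast at this
      simpa [← mul_assoc, self_mul_sign] using this
  · rintro _ ⟨x, hx, rfl⟩
    refine (Real.inner_le_Lp_mul_Lq Finset.univ v x hq.symm).trans ?_
    refine mul_le_of_le_one_right (by positivity) ?_
    exact Real.rpow_le_one (by positivity) hx (by positivity)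

/-- The `ℓ_{q*}`-norm is the support function of the unit ball of the `ℓ_q`-norm. -/
theorem isGreatest_dual {ι : Type*} [Fintype ι] [Nonempty ι] {q qs : ℝ≥0∞}
    (hq : q⁻¹ + qs⁻¹ = 1) (v : ι → ℝ) :
    IsGreatest ((fun x : ι → ℝ => ∑ i, v i * x i) ''
      {x | ‖(WithLp.toLp q x : PiLp q (fun _ : ι => ℝ))‖ ≤ 1})
      ‖(WithLp.toLp qs v : PiLp qs (fun _ : ι => ℝ))‖ := by
  have hc : q.HolderConjugate qs := ENNReal.holderConjugate_iff.2 hq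
  rcases eq_or_ne q ∞ with rfl | hqt
  · obtain rfl : qs = 1 := by simpa using hq
    exact isGreatest_dual_top v
  rcases eq_or_ne qs ∞ with rfl | hqst
  · obtain rfl : q = 1 := by simpa using hq
    exact isGreatest_dual_one v
  refine isGreatest_dual_of_ne_top ?_ v
  exact ENNReal.HolderConjugate.toReal_of_ne_top hqt hqst

/-- The inner products ⟨v, x⟩ fill [-N, N]: symmetry of the ball gives the lower bound, and
multiples of the extremal vector reach every value. -/
theorem projLength_lqBall {n : ℕ} [NeZero n] {q qs : ℝ≥0∞} [Fact (1 ≤ q)]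
    (hq : q⁻¹ + qs⁻¹ = 1) (v : EuclideanSpace ℝ (Fin n)) (hv : ‖v‖ = 1) :
    projLength v (lqBall n q) =
      2 * ‖(WithLp.toLp qs v.ofLp : PiLp qs (fun _ : Fin n => ℝ))‖ := by
  set N := ‖(WithLp.toLp qs v.ofLp : PiLp qs (fun _ : Fin n => ℝ))‖ with hN
  obtain ⟨⟨y, hy, hyN⟩, hub⟩ := isGreatest_dual hq v.ofLp
  rw [← hN] at hyN hub
  have hinner : ∀ x : EuclideanSpace ℝ (Fin n), inner ℝ v x = ∑ i, v.ofLp i * x.ofLp i := by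
    intro x
    simp [PiLp.inner_apply, mul_comm]
  have hN0 : 0 ≤ N := hub ⟨0, by simp [show (WithLp.toLp q (0 : Fin n → ℝ)) = 0 from rfl], by simp⟩
  have himg : (ℝ ∙ v).starProjection '' lqBall n q = (fun r : ℝ => r • v) '' Icc (-N) N := by
    simp only [Submodule.starProjection_unit_singleton ℝ hv]
    rw [← image_image (fun r : ℝ => r • v) (fun x => inner ℝ v x)]
    congr 1
    ext r
    constructor
    · rintro ⟨x, hx, rfl⟩
      refine ⟨?_, hub ⟨x.ofLp, hx, (hinner x).symm⟩⟩
      have := hub ⟨-x.ofLp, by simpa [lqBall, WithLp.toLp_neg, norm_neg] using hx, rfl⟩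
      simp only [Pi.neg_apply, mul_neg, Finset.sum_neg_distrib] at this
      simp only [hinner]
      linarith
    · rintro ⟨h1, h2⟩
      -- The scaling r / N below needs N ≠ 0.
      rcases hN0.eq_or_lt with h0 | h0
      · obtain rfl : r = 0 := by linarith
        exact ⟨0, by simp [lqBall, show (WithLp.toLp q (0 : Fin n → ℝ)) = 0 from rfl], by simp⟩
      · refine ⟨WithLp.toLp 2 ((r / N) • y), ?_, ?_⟩
        · change ‖WithLp.toLp q ((r / N) • y)‖ ≤ 1
          rw [WithLp.toLp_smul, norm_smul]
          have : ‖r / N‖ ≤ 1 := by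
            rw [Real.norm_eq_abs, abs_div, abs_of_pos h0, div_le_one h0]
            exact abs_le.2 ⟨h1, h2⟩
          exact mul_le_one₀ this (norm_nonneg _) hy
        · simp only [hinner, Pi.smul_apply, smul_eq_mul]
          rw [show ∑ i, v.ofLp i * (r / N * y i) = r / N * ∑ i, v.ofLp i * y i by
            rw [Finset.mul_sum]; congr 1; ext i; ring]
          simp only [hyN]
          field_simp
  have hv' : ‖v‖₊ = 1 := by ext; exact hv
  rw [projLength, himg, hausdorffMeasure_smul_right_image, hv', one_smul, hausdorffMeasure_real,
    Real.volume_Icc, ENNReal.toReal_ofReal (by linarith)]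
  ring

/-! ### Normalized Gaussian vectors are uniform on the sphere -/

section StdGaussian

variable {E : Type*} [NormedAddCommGroup E] [InnerProductSpace ℝ E] [FiniteDimensional ℝ E]
  [MeasurableSpace E] [BorelSpace E]

/-- Both sides are finite measures with the same characteristic function. The radial density is what
makes polar coordinates usable. -/
theorem stdGaussian_eq_withDensity :
    stdGaussian E = (volume : Measure E).withDensity fun x => ENNReal.ofReal
      ((2 * Real.pi) ^ (-(Module.finrank ℝ E : ℝ) / 2) * Real.exp (-(1 / 2) * ‖x‖ ^ 2)) := by
  have hpi : (0 : ℝ) < 2 * Real.pi := by positivity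
  have hint : Integrable fun x : E => Real.exp (-(1 / 2) * ‖x‖ ^ 2) := by
    have h := GaussianFourier.integrable_cexp_neg_mul_sq_norm_add (V := E) (b := 1 / 2)
      (by norm_num) 0 0
    refine (h.re).congr (ae_of_all _ fun x => ?_)
    simp only [zero_mul, add_zero]
    rw [show (-(1 / 2 : ℂ) * (‖x‖ : ℂ) ^ 2) = ((-(1 / 2) * ‖x‖ ^ 2 : ℝ) : ℂ) by push_cast; ring]
    exact Complex.exp_ofReal_re _
  have hfin : IsFiniteMeasure ((volume : Measure E).withDensity fun x => ENNReal.ofReal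
      ((2 * Real.pi) ^ (-(Module.finrank ℝ E : ℝ) / 2) * Real.exp (-(1 / 2) * ‖x‖ ^ 2))) :=
    isFiniteMeasure_withDensity_ofReal (hint.const_mul _).2
  apply Measure.ext_of_charFun
  ext t
  rw [charFun_stdGaussian, charFun_apply, integral_withDensity_eq_integral_toReal_smul
    (by fun_prop) (by simp)]
  have h := GaussianFourier.integral_cexp_neg_mul_sq_norm_add (V := E) (b := 1 / 2)
      (by norm_num) Complex.I t
  have hfun : (fun x : E => (ENNReal.ofReal ((2 * Real.pi) ^ (-(Module.finrank ℝ E : ℝ) / 2) *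
      Real.exp (-(1 / 2) * ‖x‖ ^ 2))).toReal • Complex.exp (inner ℝ x t * Complex.I)) =
      fun x => (((2 * Real.pi) ^ (-(Module.finrank ℝ E : ℝ) / 2) : ℝ) : ℂ) *
        Complex.exp (-(1 / 2) * (‖x‖ : ℂ) ^ 2 + Complex.I * (inner ℝ t x : ℝ)) := by
    ext x
    rw [ENNReal.toReal_ofReal (by positivity), Complex.real_smul, Complex.exp_add,
      real_inner_comm]
    push_cast
    ring_nf
  rw [hfun, integral_const_mul, h]
  have h2 : ((Real.pi : ℂ) / (1 / 2)) ^ ((Module.finrank ℝ E : ℂ) / 2) =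
      (((2 * Real.pi) ^ ((Module.finrank ℝ E : ℝ) / 2) : ℝ) : ℂ) := by
    rw [Complex.ofReal_cpow hpi.le]
    push_cast
    congr 1
    ring
  rw [h2, ← mul_assoc, ← Complex.ofReal_mul, ← Real.rpow_add hpi]
  simp [neg_div, Complex.I_sq]
  congr 1
  ring

/-- In polar coordinates Lebesgue measure is a product and the Gaussian density depends on the
radius alone, so the integral factors. -/
theorem lintegral_normalize_stdGaussian [Nontrivial E] {f : Metric.sphere (0 : E) 1 → ℝ≥0∞}
    (hf : Measurable f) {g : E → ℝ≥0∞}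
    (hfg : ∀ x (hx : x ∈ ({0}ᶜ : Set E)), g x = f (homeomorphUnitSphereProd E ⟨x, hx⟩).1) :
    ∫⁻ x, g x ∂(stdGaussian E) = ((volume : Measure E).toSphere univ)⁻¹ *
      ∫⁻ s, f s ∂(volume : Measure E).toSphere := by
  set ρ : ℝ → ℝ≥0∞ := fun r => ENNReal.ofReal
      ((2 * Real.pi) ^ (-(Module.finrank ℝ E : ℝ) / 2) * Real.exp (-(1 / 2) * r ^ 2)) with hρ
  have hρm : Measurable ρ := by fun_prop
  have key : ∀ {f : Metric.sphere (0 : E) 1 → ℝ≥0∞} (_ : Measurable f) {g : E → ℝ≥0∞}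
      (_ : ∀ x (hx : x ∈ ({0}ᶜ : Set E)), g x = f (homeomorphUnitSphereProd E ⟨x, hx⟩).1),
      ∫⁻ x, g x ∂(stdGaussian E) = (∫⁻ s, f s ∂(volume : Measure E).toSphere) *
        ∫⁻ r : Ioi (0 : ℝ), ρ r ∂(Measure.volumeIoiPow (Module.finrank ℝ E - 1)) := by
    intro f hf g hfg
    rw [stdGaussian_eq_withDensity,
      lintegral_withDensity_eq_lintegral_mul_non_measurable _ (by fun_prop) (by simp),
      ← lintegral_prod_mul hf.aemeasurable (by fun_prop),
      ← ((volume : Measure E).measurePreserving_homeomorphUnitSphereProd).lintegral_comp_emb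
        (Homeomorph.measurableEmbedding _)]
    conv_lhs => rw [← restrict_compl_singleton (μ := (volume : Measure E)) (0 : E)]
    rw [← lintegral_subtype_comap (measurableSet_singleton _).compl]
    refine lintegral_congr fun x => ?_
    simp only [Pi.mul_apply, hfg x.1 x.2, homeomorphUnitSphereProd_apply_snd_coe, hρ]
    rw [mul_comm]
  -- Total mass one identifies the radial integral as the inverse of the surface area.
  have h1 := key (f := fun _ => 1) measurable_const (g := fun _ => 1) (fun _ _ => rfl)
  simp only [lintegral_const, measure_univ, one_mul] at h1
  rw [key hf hfg, mul_comm]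
  congr 1
  exact ENNReal.eq_inv_of_mul_eq_one_left (by rw [mul_comm]; exact h1.symm)

end StdGaussian

theorem map_uniformSphere_eq_map_stdGaussian {n : ℕ} [NeZero n]
    {F : EuclideanSpace ℝ (Fin n) → ℝ} (hF : Measurable F) :
    (uniformSphere n).map (fun s : Metric.sphere (0 : EuclideanSpace ℝ (Fin n)) 1 => F s) =
      (stdGaussian (EuclideanSpace ℝ (Fin n))).map (fun x => F (‖x‖⁻¹ • x)) := by
  have : Nontrivial (EuclideanSpace ℝ (Fin n)) := Module.nontrivial_of_finrank_pos (R := ℝ)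
    (by simpa using NeZero.pos n)
  have h1 : Measurable fun s : Metric.sphere (0 : EuclideanSpace ℝ (Fin n)) 1 => F s :=
    hF.comp measurable_subtype_coe
  have h2 : Measurable fun x : EuclideanSpace ℝ (Fin n) => F (‖x‖⁻¹ • x) :=
    hF.comp (by fun_prop)
  ext A hA
  rw [Measure.map_apply h1 hA, Measure.map_apply h2 hA, ← lintegral_indicator_one (h1 hA),
    ← lintegral_indicator_one (h2 hA), lintegral_normalize_stdGaussian
      (f := ((fun s : Metric.sphere (0 : EuclideanSpace ℝ (Fin n)) 1 => F s) ⁻¹' A).indicator 1)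
      (measurable_one.indicator (h1 hA)), uniformSphere, lintegral_smul_measure]
  · rfl
  · intro x hx
    have hx' := homeomorphUnitSphereProd_apply_fst_coe (EuclideanSpace ℝ (Fin n)) ⟨x, hx⟩
    by_cases h : F (‖x‖⁻¹ • x) ∈ A
    · rw [indicator_of_mem (show x ∈ (fun x => F (‖x‖⁻¹ • x)) ⁻¹' A from h), indicator_of_mem]
      · rfl
      · change F _ ∈ A
        rw [hx']
        exact h
    · rw [indicator_of_notMem (show x ∉ (fun x => F (‖x‖⁻¹ • x)) ⁻¹' A from h),
        indicator_of_notMem]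
      change F _ ∉ A
      rw [hx']
      exact h

/-! ### Boundedness in probability, delta method, weak convergence -/

section Convergence

/-- A sequence of random vectors that is bounded in probability. -/
def BoundedInProbability {Ω E : Type*} [MeasurableSpace Ω] [Norm E] (Q : Measure Ω)
    (X : ℕ → Ω → E) : Prop :=
  ∀ δ : ℝ≥0∞, 0 < δ → ∃ K : ℝ, ∀ n, Q {ω | K < ‖X n ω‖} ≤ δ

/-- If `X n` is bounded in probability and `Y n` is uniformly small on the events `‖X n‖ ≤ K`, for
every `K`, then `Y n` tends to zero in probability. -/
theorem BoundedInProbability.tendstoInMeasure_zero {Ω E : Type*} [MeasurableSpace Ω]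
    {Q : Measure Ω} [Norm E] {X : ℕ → Ω → E} {Y : ℕ → Ω → ℝ} (hX : BoundedInProbability Q X)
    (hY : ∀ K ε : ℝ, 0 < ε → ∀ᶠ n in atTop, ∀ ω, ‖X n ω‖ ≤ K → |Y n ω| < ε) :
    TendstoInMeasure Q Y atTop 0 := by
  rw [tendstoInMeasure_iff_norm]
  intro ε hε
  rw [ENNReal.tendsto_nhds_zero]
  intro δ hδ
  obtain ⟨K, hK⟩ := hX δ hδ
  filter_upwards [hY K ε hε] with n hn
  refine (measure_mono fun ω hω => ?_).trans (hK n)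
  by_contra h
  have h1 := hn ω (not_lt.1 h)
  simp only [Pi.zero_apply, sub_zero, Real.norm_eq_abs, mem_ofPred_eq] at hω
  exact absurd hω (not_le.2 h1)

theorem BoundedInProbability.prodMk {Ω E F : Type*} [MeasurableSpace Ω] {Q : Measure Ω}
    [NormedAddCommGroup E] [NormedAddCommGroup F] {X : ℕ → Ω → E} {Y : ℕ → Ω → F}
    (hX : BoundedInProbability Q X) (hY : BoundedInProbability Q Y) :
    BoundedInProbability Q fun n ω => (X n ω, Y n ω) := by
  intro δ hδ
  obtain ⟨K, hK⟩ := hX (δ / 2) (ENNReal.half_pos hδ.ne')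
  obtain ⟨L, hL⟩ := hY (δ / 2) (ENNReal.half_pos hδ.ne')
  refine ⟨max K L, fun n => ?_⟩
  calc Q {ω | max K L < ‖(X n ω, Y n ω)‖} ≤ Q ({ω | K < ‖X n ω‖} ∪ {ω | L < ‖Y n ω‖}) := by
        refine measure_mono fun ω (hω : max K L < ‖(X n ω, Y n ω)‖) => ?_
        rw [Prod.norm_mk, lt_max_iff] at hω
        rcases hω with h | h
        · exact Or.inl ((le_max_left _ _).trans_lt h)
        · exact Or.inr ((le_max_right _ _).trans_lt h)
    _ ≤ δ / 2 + δ / 2 := (measure_union_le _ _).trans (add_le_add (hK n) (hL n))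
    _ = δ := ENNReal.add_halves δ

theorem tendsto_sqrt_natCast : Tendsto (fun n : ℕ => √(n : ℝ)) atTop atTop :=
  Real.tendsto_sqrt_atTop.comp tendsto_natCast_atTop_atTop

section DeltaMethod

variable {Ω E : Type*} [MeasurableSpace Ω] {Q : Measure Ω} [NormedAddCommGroup E] [NormedSpace ℝ E]
  {D : ℕ → Ω → E} {x₀ : E} {h : E → ℝ} {h' : E →L[ℝ] ℝ}

theorem eventually_norm_sub_lt_of_sqrt_smul_le (x₀ : E) (K : ℝ) {ρ : ℝ} (hρ : 0 < ρ) :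
    ∀ᶠ n : ℕ in atTop, ∀ x : E, ‖√(n : ℝ) • (x - x₀)‖ ≤ K → ‖x - x₀‖ < ρ := by
  filter_upwards [tendsto_sqrt_natCast.eventually_gt_atTop (K / ρ),
    tendsto_sqrt_natCast.eventually_gt_atTop 0] with n hn hn0 x hx
  rw [norm_smul, Real.norm_of_nonneg hn0.le] at hx
  rw [div_lt_iff₀ hρ] at hn
  exact lt_of_mul_lt_mul_left (hx.trans_lt hn) hn0.le

/-- The delta method: the linearization error is negligible in probability. -/
theorem BoundedInProbability.delta_method
    (hD : BoundedInProbability Q fun n ω => √(n : ℝ) • (D n ω - x₀)) (hh : HasFDerivAt h h' x₀) :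
    TendstoInMeasure Q (fun (n : ℕ) ω => √(n : ℝ) * (h (D n ω) - h x₀) - h' (√(n : ℝ) • (D n ω - x₀)))
      atTop 0 := by
  refine hD.tendstoInMeasure_zero fun K ε hε => ?_
  -- K may be negative or zero; |K| + 1 keeps the quotient meaningful and the final bound strict.
  have hpos : 0 < ε / (|K| + 1) := by positivity
  obtain ⟨ρ, hρ, hball⟩ := Metric.eventually_nhds_iff.1 (hh.isLittleO.bound hpos)
  filter_upwards [eventually_norm_sub_lt_of_sqrt_smul_le x₀ K hρ] with n hn ω hω
  have h1 := hball (by rw [dist_eq_norm]; exact hn _ hω)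
  have h0 : 0 ≤ √(n : ℝ) := Real.sqrt_nonneg _
  rw [map_smul, smul_eq_mul, ← mul_sub, abs_mul, abs_of_nonneg h0]
  rw [norm_smul, Real.norm_of_nonneg h0] at hω
  rw [Real.norm_eq_abs] at h1
  calc √(n : ℝ) * |h (D n ω) - h x₀ - h' (D n ω - x₀)|
      ≤ √(n : ℝ) * (ε / (|K| + 1) * ‖D n ω - x₀‖) := mul_le_mul_of_nonneg_left h1 h0
    _ = ε / (|K| + 1) * (√(n : ℝ) * ‖D n ω - x₀‖) := by ring
    _ ≤ ε / (|K| + 1) * |K| := mul_le_mul_of_nonneg_left (hω.trans (le_abs_self K)) hpos.le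
    _ < ε / (|K| + 1) * (|K| + 1) := mul_lt_mul_of_pos_left (lt_add_one _) hpos
    _ = ε := by field_simp

/-- Differentiability gives h(D_n) - h(x₀) = O(‖D_n - x₀‖), of order n^{-1/2} in probability, so any
factor that is o(√n) is absorbed. -/
theorem BoundedInProbability.tendstoInMeasure_mul_sub
    (hD : BoundedInProbability Q fun n ω => √(n : ℝ) • (D n ω - x₀)) (hh : HasFDerivAt h h' x₀)
    {a : ℕ → ℝ} (ha : Tendsto (fun n : ℕ => a n / √(n : ℝ)) atTop (𝓝 0)) :
    TendstoInMeasure Q (fun n ω => a n * (h (D n ω) - h x₀)) atTop 0 := by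
  refine hD.tendstoInMeasure_zero fun K ε hε => ?_
  obtain ⟨C, hC, hO⟩ := hh.isBigO_sub.exists_pos
  obtain ⟨ρ, hρ, hball⟩ := Metric.eventually_nhds_iff.1 hO.bound
  have hpos : 0 < ε / (C * (|K| + 1)) := by positivity
  filter_upwards [eventually_norm_sub_lt_of_sqrt_smul_le x₀ K hρ,
    (tendsto_zero_iff_abs_tendsto_zero _).1 ha |>.eventually_lt_const hpos,
    tendsto_sqrt_natCast.eventually_gt_atTop 0] with n hn han h0 ω hω
  have h1 := hball (by rw [dist_eq_norm]; exact hn _ hω)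
  rw [norm_smul, Real.norm_of_nonneg h0.le] at hω
  rw [Real.norm_eq_abs] at h1
  simp only [Function.comp_apply] at han
  calc |a n * (h (D n ω) - h x₀)| = |a n| * |h (D n ω) - h x₀| := abs_mul _ _
    _ ≤ |a n| * (C * ‖D n ω - x₀‖) := mul_le_mul_of_nonneg_left h1 (abs_nonneg _)
    _ = |a n / √(n : ℝ)| * (C * (√(n : ℝ) * ‖D n ω - x₀‖)) := by
        rw [abs_div, abs_of_pos h0]; field_simp
    _ ≤ |a n / √(n : ℝ)| * (C * |K|) := by
        have := hω.trans (le_abs_self K)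
        gcongr
    _ ≤ |a n / √(n : ℝ)| * (C * (|K| + 1)) := by gcongr; linarith
    _ < ε / (C * (|K| + 1)) * (C * (|K| + 1)) := by gcongr
    _ = ε := by field_simp

end DeltaMethod

/-- By Chebyshev's inequality, the normalized fluctuations of empirical means are bounded in
probability. -/
theorem boundedInProbability_sqrt_mul_average_sub {Ω : Type*} [MeasurableSpace Ω] {Q : Measure Ω}
    [IsProbabilityMeasure Q] {Y : ℕ → Ω → ℝ} (hY : MemLp (Y 0) 2 Q) (hindep : iIndepFun Y Q)
    (hident : ∀ i, IdentDistrib (Y i) (Y 0) Q Q) :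
    BoundedInProbability Q fun n ω =>
      √(n : ℝ) • ((∑ k ∈ Finset.range n, Y k ω) / n - ∫ ω, Y 0 ω ∂Q) := by
  intro δ hδ
  have hYi : ∀ i, MemLp (Y i) 2 Q := fun i => (hident i).memLp_iff.2 hY
  set v := Var[Y 0; Q] with hv
  have hlim : Tendsto (fun K : ℝ => ENNReal.ofReal (v / K ^ 2)) atTop (𝓝 0) := by
    have : Tendsto (fun K : ℝ => v / K ^ 2) atTop (𝓝 0) :=
      tendsto_const_nhds.div_atTop (tendsto_pow_atTop two_ne_zero)
    simpa using ENNReal.tendsto_ofReal this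
  obtain ⟨K, hK, hK0⟩ := (((ENNReal.tendsto_nhds_zero.1 hlim) δ hδ).and
    (eventually_gt_atTop 0)).exists
  refine ⟨K, fun n => ?_⟩
  rcases Nat.eq_zero_or_pos n with rfl | hn
  · simp [hK0.not_gt]
  have hn' : (0 : ℝ) < n := by exact_mod_cast hn
  have hsum : MemLp (∑ k ∈ Finset.range n, Y k) 2 Q := memLp_finsetSum' _ fun i _ => hYi i
  have hmean : ∫ ω, (∑ k ∈ Finset.range n, Y k) ω ∂Q = n * ∫ ω, Y 0 ω ∂Q := by
    simp only [Finset.sum_apply]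
    rw [integral_finsetSum _ fun i _ => (hYi i).integrable one_le_two]
    simp [fun i => (hident i).integral_eq]
  have hvar : Var[∑ k ∈ Finset.range n, Y k; Q] = n * v := by
    rw [IndepFun.variance_sum (fun i _ => hYi i) fun i _ j _ hij => hindep.indepFun hij]
    simp [fun i => (hident i).variance_eq, hv]
  have hcheb := meas_ge_le_variance_div_sq hsum (c := K * √(n : ℝ)) (by positivity)
  rw [hmean, hvar, mul_pow, Real.sq_sqrt hn'.le, mul_comm (K ^ 2), mul_div_mul_left _ _ hn'.ne']
    at hcheb
  refine (measure_mono fun ω hω => ?_).trans (hcheb.trans hK)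
  simp only [mem_ofPred_eq, norm_smul, Real.norm_eq_abs, abs_of_nonneg (Real.sqrt_nonneg _),
    Finset.sum_apply] at hω ⊢
  have h1 : |(∑ k ∈ Finset.range n, Y k ω) - n * ∫ ω, Y 0 ω ∂Q| =
      √(n : ℝ) * (√(n : ℝ) * |(∑ k ∈ Finset.range n, Y k ω) / n - ∫ ω, Y 0 ω ∂Q|) := by
    rw [← mul_assoc, Real.mul_self_sqrt hn'.le, ← abs_of_pos hn', ← abs_mul, abs_of_pos hn']
    congr 1
    field_simp
  rw [h1, mul_comm K]
  exact mul_le_mul_of_nonneg_left hω.le (Real.sqrt_nonneg _)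

/-- Pointwise convergence of the distribution functions, at every point, implies weak
convergence. -/
theorem tendsto_probabilityMeasure_of_tendsto_measureReal_Iic {ι : Type*} {l : Filter ι}
    [l.IsCountablyGenerated] {μ : ι → ProbabilityMeasure ℝ} {ν : ProbabilityMeasure ℝ}
    (h : ∀ t : ℝ, Tendsto (fun i => (μ i : Measure ℝ).real (Iic t)) l
      (𝓝 ((ν : Measure ℝ).real (Iic t)))) : Tendsto μ l (𝓝 ν) := by
  -- Half-open intervals form a π-system containing small neighbourhoods of every point, and their
  -- masses are differences of values of the distribution function.
  refine (isPiSystem_Ioc (id : ℝ → ℝ) id).tendsto_probabilityMeasure_of_tendsto_of_mem ?_ ?_ ?_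
  · rintro _ ⟨a, b, -, rfl⟩
    exact measurableSet_Ioc
  · intro u hu x hx
    obtain ⟨ε, hε, hball⟩ := Metric.isOpen_iff.1 hu x hx
    refine ⟨Ioc (x - ε / 2) (x + ε / 2), ⟨_, _, by simp only [id]; linarith, rfl⟩,
      Ioc_mem_nhds (by linarith) (by linarith), fun y hy => hball ?_⟩
    rw [Metric.mem_ball, Real.dist_eq, abs_lt]
    constructor <;> linarith [hy.1, hy.2]
  · rintro _ ⟨a, b, hab, rfl⟩
    replace hab : a < b := hab
    have key : ∀ ρ : ProbabilityMeasure ℝ, ((ρ (Ioc a b) : ℝ≥0) : ℝ) =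
        (ρ : Measure ℝ).real (Iic b) - (ρ : Measure ℝ).real (Iic a) := by
      intro ρ
      rw [← Iic_sdiff_Iic, ← measureReal_sdiff (μ := (ρ : Measure ℝ))
        (Iic_subset_Iic.2 hab.le) measurableSet_Iic]
      rfl
    rw [← NNReal.tendsto_coe]
    simp only [id, key]
    exact (h b).sub (h a)

theorem MeasureTheory.TendstoInDistribution.of_map_eq {ι E Ω' Ω'' : Type*} {Ω : ι → Type*}
    {m : ∀ i, MeasurableSpace (Ω i)} {P : (i : ι) → Measure (Ω i)}
    [∀ i, IsProbabilityMeasure (P i)] {m' : MeasurableSpace Ω'} {μ' : Measure Ω'}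
    [IsProbabilityMeasure μ'] {m'' : MeasurableSpace Ω''} {Q : Measure Ω''}
    [IsProbabilityMeasure Q] {mE : MeasurableSpace E} [TopologicalSpace E] [OpensMeasurableSpace E]
    {X : (i : ι) → Ω i → E} {Y : ι → Ω'' → E} {Z : Ω' → E} {l : Filter ι}
    (h : TendstoInDistribution Y l Z (fun _ => Q) μ') (hX : ∀ i, AEMeasurable (X i) (P i))
    (hmap : ∀ i, (P i).map (X i) = Q.map (Y i)) : TendstoInDistribution X l Z P μ' where
  forall_aemeasurable := hX
  aemeasurable_limit := h.aemeasurable_limit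
  tendsto := by
    refine h.tendsto.congr fun i => ?_
    exact Subtype.ext (hmap i).symm

end Convergence

/-! ### Absolute moments of a Gaussian variable and the limiting variance -/

section GaussianMoments

theorem integral_abs_rpow_gaussianReal {s : ℝ} (hs : -1 < s) :
    ∫ x, |x| ^ s ∂(gaussianReal 0 1) = 2 ^ (s / 2) * Real.Gamma ((s + 1) / 2) / √Real.pi := by
  rw [integral_gaussianReal_eq_integral_smul one_ne_zero]
  have h1 : ∀ x : ℝ, gaussianPDFReal 0 1 x • |x| ^ s =
      (√(2 * Real.pi))⁻¹ * (|x| ^ s * Real.exp (-(1 / 2) * |x| ^ (2 : ℝ))) := by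
    intro x
    rw [gaussianPDFReal, smul_eq_mul, Real.rpow_two, sq_abs]
    simp only [NNReal.coe_one, mul_one, sub_zero]
    ring_nf
  simp only [h1]
  rw [integral_const_mul, integral_comp_abs (f := fun x => x ^ s * Real.exp (-(1 / 2) * x ^ (2 : ℝ))),
    integral_rpow_mul_exp_neg_mul_rpow two_pos hs (by norm_num)]
  have h2 : (1 / 2 : ℝ) ^ (-(s + 1) / 2) = 2 ^ (s / 2) * √2 := by
    rw [one_div, Real.inv_rpow zero_le_two, ← Real.rpow_neg zero_le_two, Real.sqrt_eq_rpow,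
      ← Real.rpow_add two_pos]
    ring_nf
  rw [h2, Real.sqrt_mul zero_le_two]
  field_simp

theorem momentM_two_eq_integral {s : ℝ} (hs : -1 < s) :
    momentM 2 s = ∫ x, |x| ^ s ∂(gaussianReal 0 1) := by
  have h1 : s + 1 ≠ 0 := by linarith
  rw [integral_abs_rpow_gaussianReal hs, momentM, add_comm 1 ((s + 1) / 2),
    Real.Gamma_add_one (by positivity), add_comm (1 : ℝ) (1 / 2), Real.Gamma_add_one (by norm_num),
    Real.Gamma_one_half_eq]
  field_simp

theorem momentM_two_pos {s : ℝ} (hs : -1 < s) : 0 < momentM 2 s := by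
  have hG : 0 < Real.Gamma ((s + 1) / 2) := Real.Gamma_pos_of_pos (by linarith)
  have hpi := Real.pi_pos
  rw [momentM_two_eq_integral hs, integral_abs_rpow_gaussianReal hs]
  positivity

theorem integral_abs_rpow_add_two_gaussianReal {s : ℝ} (hs : -1 < s) :
    ∫ x, |x| ^ (s + 2) ∂(gaussianReal 0 1) = (s + 1) * ∫ x, |x| ^ s ∂(gaussianReal 0 1) := by
  have h1 : s + 1 ≠ 0 := by linarith
  rw [integral_abs_rpow_gaussianReal hs, integral_abs_rpow_gaussianReal (by linarith),
    show (s + 2 + 1) / 2 = (s + 1) / 2 + 1 by ring, Real.Gamma_add_one (by positivity),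
    show (s + 2) / 2 = s / 2 + 1 by ring, Real.rpow_add two_pos, Real.rpow_one]
  field_simp

theorem integral_sq_gaussianReal : ∫ x, |x| ^ (2 : ℝ) ∂(gaussianReal 0 1) = 1 := by
  have := integral_abs_rpow_add_two_gaussianReal (s := 0) (by norm_num)
  simpa using this

theorem integral_pow_four_gaussianReal : ∫ x, |x| ^ (4 : ℝ) ∂(gaussianReal 0 1) = 3 := by
  have := integral_abs_rpow_add_two_gaussianReal (s := 2) (by norm_num)
  rw [integral_sq_gaussianReal] at this
  norm_num at this ⊢
  exact this

theorem integrable_abs_rpow_gaussianReal {s : ℝ} (hs : 0 ≤ s) :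
    Integrable (fun x : ℝ => |x| ^ s) (gaussianReal 0 1) := by
  rcases hs.eq_or_lt with rfl | h
  · simp
  · lift s to ℝ≥0 using hs
    have h0 : (s : ℝ≥0∞) ≠ 0 := by exact_mod_cast h.ne'
    simpa using (memLp_id_gaussianReal (μ := 0) (v := 1) s).integrable_norm_rpow h0
      ENNReal.coe_ne_top

theorem memLp_abs_rpow_gaussianReal {s : ℝ} (hs : 0 ≤ s) :
    MemLp (fun x : ℝ => |x| ^ s) 2 (gaussianReal 0 1) := by
  rw [memLp_two_iff_integrable_sq (by fun_prop)]
  refine (integrable_abs_rpow_gaussianReal (s := s * 2) (by positivity)).congr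
    (ae_of_all _ fun x => ?_)
  simp only [Real.rpow_mul (abs_nonneg x), Real.rpow_two]

theorem memLp_linearization {r : ℝ} (hr : 0 ≤ r) (M : ℝ) :
    MemLp (fun x : ℝ => |x| ^ r / M / r - |x| ^ (2 : ℝ) / 2) 2 (gaussianReal 0 1) := by
  have h1 := (memLp_abs_rpow_gaussianReal hr).mul_const (M⁻¹ * r⁻¹)
  have h2 := (memLp_abs_rpow_gaussianReal zero_le_two).mul_const (2⁻¹)
  simp only [div_eq_mul_inv, mul_assoc]
  exact h1.sub h2

/-- The variable is the linearization of u^{1/r} v^{-1/2} at (1, 1). As E|g|^{r+2} = (r+1) E|g|^r,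
the covariance of |g|^r / M and g² is r; so the cross term contributes -1, and g²/2 contributes 1/2,
whence the -1/2. -/
theorem variance_linearization {r : ℝ} (hr : 0 < r) :
    Var[fun x : ℝ => |x| ^ r / momentM 2 r / r - |x| ^ (2 : ℝ) / 2; gaussianReal 0 1] =
      projVariance r := by
  set M := momentM 2 r with hM
  have hMr : ∫ x, |x| ^ r ∂(gaussianReal 0 1) = M := (momentM_two_eq_integral (by linarith)).symm
  have hM2 : (∫ x, |x| ^ (2 * r) ∂(gaussianReal 0 1)) / M ^ 2 =
      √Real.pi * (Real.Gamma ((2 * r + 1) / 2) / Real.Gamma ((r + 1) / 2) ^ 2) := by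
    have hpi := Real.pi_pos
    rw [← hMr, integral_abs_rpow_gaussianReal (by linarith),
      integral_abs_rpow_gaussianReal (by linarith), show 2 * r / 2 = r / 2 + r / 2 by ring,
      Real.rpow_add two_pos]
    have hG : 0 < Real.Gamma ((r + 1) / 2) := Real.Gamma_pos_of_pos (by linarith)
    field_simp
  have hMpos : 0 < M := momentM_two_pos (by linarith)
  have i1 := integrable_abs_rpow_gaussianReal hr.le
  have i2 := integrable_abs_rpow_gaussianReal zero_le_two
  have i3 := integrable_abs_rpow_gaussianReal (s := 2 * r) (by linarith)
  have i4 := integrable_abs_rpow_gaussianReal (s := r + 2) (by linarith)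
  have i5 := integrable_abs_rpow_gaussianReal (s := 4) (by norm_num)
  have hL := memLp_linearization hr.le M
  have hsq : ∀ x : ℝ, (|x| ^ r / M / r - |x| ^ (2 : ℝ) / 2) ^ 2 =
      |x| ^ (2 * r) * (1 / (M ^ 2 * r ^ 2)) - |x| ^ (r + 2) * (1 / (M * r)) +
        |x| ^ (4 : ℝ) * (1 / 4) := by
    intro x
    rw [show 2 * r = r + r by ring, show (4 : ℝ) = 2 + 2 by norm_num,
      Real.rpow_add_of_nonneg (abs_nonneg x) hr.le hr.le,
      Real.rpow_add_of_nonneg (abs_nonneg x) hr.le zero_le_two,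
      Real.rpow_add_of_nonneg (abs_nonneg x) zero_le_two zero_le_two]
    field_simp
    ring
  rw [variance_eq_sub hL]
  simp only [Pi.pow_apply, hsq]
  have i6 := (i3.mul_const (1 / (M ^ 2 * r ^ 2))).sub (i4.mul_const (1 / (M * r)))
  rw [integral_add (by exact i6) (i5.mul_const _), integral_sub (i3.mul_const _) (i4.mul_const _),
    integral_sub ((i1.div_const _).div_const _) (i2.div_const _)]
  simp only [integral_mul_const, integral_div]
  rw [integral_abs_rpow_add_two_gaussianReal (by linarith), integral_sq_gaussianReal,
    integral_pow_four_gaussianReal, hMr, projVariance, ← hM2]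
  field_simp
  ring

end GaussianMoments

/-! ### Finite q*: central limit theorem for the ratio of norms -/

section GaussianSequence

variable {Ω : Type*} [MeasurableSpace Ω] {Q : Measure Ω} {X : ℕ → Ω → ℝ}

theorem hasLaw_toLp_gaussianSequence (hX : ∀ i, HasLaw (X i) (gaussianReal 0 1) Q)
    (hindep : iIndepFun X Q) (n : ℕ) :
    HasLaw (fun ω => WithLp.toLp 2 fun i : Fin n => X i ω)
      (stdGaussian (EuclideanSpace ℝ (Fin n))) Q := by
  have h1 : HasLaw (fun ω (i : Fin n) => X i ω) (Measure.pi fun _ => gaussianReal 0 1) Q :=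
    (hindep.precomp Fin.val_injective).hasLaw_pi fun i => hX i
  have h2 : HasLaw (WithLp.toLp 2) (stdGaussian (EuclideanSpace ℝ (Fin n)))
      (Measure.pi fun _ : Fin n => gaussianReal 0 1) := ⟨by fun_prop, map_pi_eq_stdGaussian⟩
  exact h2.comp h1

theorem map_comp_uniformSphere_eq (hX : ∀ i, HasLaw (X i) (gaussianReal 0 1) Q)
    (hindep : iIndepFun X Q) {n : ℕ} [NeZero n] {Ω' : Type*} [MeasurableSpace Ω'] {P : Measure Ω'}
    {θ : Ω' → Metric.sphere (0 : EuclideanSpace ℝ (Fin n)) 1} (hθ : HasLaw θ (uniformSphere n) P)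
    {F : EuclideanSpace ℝ (Fin n) → ℝ} (hF : Measurable F) :
    P.map (fun ω => F (θ ω)) = Q.map fun ω =>
      F (‖WithLp.toLp 2 fun i : Fin n => X i ω‖⁻¹ • WithLp.toLp 2 fun i : Fin n => X i ω) := by
  have h1 : Measurable fun s : Metric.sphere (0 : EuclideanSpace ℝ (Fin n)) 1 => F s :=
    hF.comp measurable_subtype_coe
  have h2 : Measurable fun x : EuclideanSpace ℝ (Fin n) => F (‖x‖⁻¹ • x) :=
    hF.comp (by fun_prop)
  have hG := hasLaw_toLp_gaussianSequence hX hindep n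
  have e1 := AEMeasurable.map_map_of_aemeasurable (h1.aemeasurable (μ := P.map θ)) hθ.aemeasurable
  have e2 := AEMeasurable.map_map_of_aemeasurable (h2.aemeasurable (μ := Q.map _)) hG.aemeasurable
  rw [hθ.map_eq, map_uniformSphere_eq_map_stdGaussian hF, ← hG.map_eq, e2] at e1
  exact e1.symm

theorem identDistrib_comp (hX : ∀ i, HasLaw (X i) (gaussianReal 0 1) Q) {f : ℝ → ℝ}
    (hf : Measurable f) (i : ℕ) :
    IdentDistrib (fun ω => f (X i ω)) (fun ω => f (X 0 ω)) Q Q :=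
  IdentDistrib.comp ⟨(hX i).aemeasurable, (hX 0).aemeasurable,
    (hX i).map_eq.trans (hX 0).map_eq.symm⟩ hf

theorem ProbabilityTheory.HasLaw.memLp_comp {μ : Measure ℝ} {Y : Ω → ℝ} (hY : HasLaw Y μ Q) {f : ℝ → ℝ}
    {p : ℝ≥0∞} (hf : MemLp f p μ) : MemLp (fun ω => f (Y ω)) p Q := by
  rw [← hY.map_eq] at hf
  exact hf.comp_of_map hY.aemeasurable

theorem ProbabilityTheory.HasLaw.integral_fun_comp {μ : Measure ℝ} {Y : Ω → ℝ} (hY : HasLaw Y μ Q) {f : ℝ → ℝ}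
    (hf : Measurable f) : ∫ ω, f (Y ω) ∂Q = ∫ x, f x ∂μ :=
  hY.integral_comp hf.aestronglyMeasurable

theorem hasFDerivAt_rpow_mul_inv_sqrt (s : ℝ) :
    HasFDerivAt (fun p : ℝ × ℝ => p.1 ^ s * (√p.2)⁻¹)
      (s • ContinuousLinearMap.fst ℝ ℝ ℝ - (1 / 2 : ℝ) • ContinuousLinearMap.snd ℝ ℝ ℝ) (1, 1) := by
  have h1 : HasDerivAt (fun u : ℝ => u ^ s) s 1 := by
    simpa using Real.hasDerivAt_rpow_const (x := 1) (p := s) (Or.inl one_ne_zero)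
  have h2 : HasDerivAt (fun v : ℝ => (√v)⁻¹) (-(1 / 2)) 1 := by
    simpa using (Real.hasDerivAt_sqrt one_ne_zero).fun_inv (by simp)
  have p1 : HasFDerivAt (fun p : ℝ × ℝ => p.1) (ContinuousLinearMap.fst ℝ ℝ ℝ) (1, 1) :=
    hasFDerivAt_fst
  have p2 : HasFDerivAt (fun p : ℝ × ℝ => p.2) (ContinuousLinearMap.snd ℝ ℝ ℝ) (1, 1) :=
    hasFDerivAt_snd
  have h3 := (HasDerivAt.comp_hasFDerivAt (f := fun p : ℝ × ℝ => p.1) (1, 1) h1 p1).mul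
    (HasDerivAt.comp_hasFDerivAt (f := fun p : ℝ × ℝ => p.2) (1, 1) h2 p2)
  refine h3.congr_fderiv ?_
  ext <;> simp

variable [IsProbabilityMeasure Q]

theorem boundedInProbability_average_comp (hX : ∀ i, HasLaw (X i) (gaussianReal 0 1) Q)
    (hindep : iIndepFun X Q) {f : ℝ → ℝ} (hf : Measurable f) (hf2 : MemLp f 2 (gaussianReal 0 1)) :
    BoundedInProbability Q fun n ω => √(n : ℝ) •
      ((∑ k ∈ Finset.range n, f (X k ω)) / n - ∫ x, f x ∂(gaussianReal 0 1)) := by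
  have := boundedInProbability_sqrt_mul_average_sub (Q := Q) (Y := fun i ω => f (X i ω))
    ((hX 0).memLp_comp hf2) (hindep.comp (fun _ => f) fun _ => hf) (identDistrib_comp hX hf)
  rwa [(hX 0).integral_fun_comp hf] at this

/-- The central limit theorem for `‖g‖_r / ‖g‖_2`, where `g` is a standard Gaussian vector. -/
theorem tendstoInDistribution_ratio (hX : ∀ i, HasLaw (X i) (gaussianReal 0 1) Q)
    (hindep : iIndepFun X Q) {r : ℝ} (hr : 0 < r) :
    TendstoInDistribution (fun (n : ℕ) ω => √(n : ℝ) *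
        (((∑ k ∈ Finset.range n, |X k ω| ^ r / momentM 2 r) / n) ^ (1 / r) *
          (√((∑ k ∈ Finset.range n, |X k ω| ^ (2 : ℝ)) / n))⁻¹ - 1))
      atTop (fun x : ℝ => x) (fun _ => Q) (gaussianReal 0 (projVariance r).toNNReal) := by
  set M := momentM 2 r with hM
  have hXm : ∀ i, AEMeasurable (X i) Q := fun i => (hX i).aemeasurable
  have hMr : ∫ x, |x| ^ r ∂(gaussianReal 0 1) = M := (momentM_two_eq_integral (by linarith)).symm
  have hMpos : 0 < M := momentM_two_pos (by linarith)
  set W : ℝ → ℝ := fun x => |x| ^ r / M / r - |x| ^ (2 : ℝ) / 2 with hW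
  have hWm : Measurable W := by fun_prop
  have hWL : MemLp W 2 (gaussianReal 0 1) := memLp_linearization hr.le M
  have hEW : ∫ x, W x ∂(gaussianReal 0 1) = 1 / r - 1 / 2 := by
    rw [hW, integral_sub (((integrable_abs_rpow_gaussianReal hr.le).div_const _).div_const _)
      ((integrable_abs_rpow_gaussianReal zero_le_two).div_const _)]
    simp only [integral_div]
    rw [hMr, integral_sq_gaussianReal, div_self hMpos.ne']
  have hVar : Var[fun ω => W (X 0 ω); Q] = projVariance r := by
    rw [← variance_linearization hr, ← (hX 0).map_eq, variance_map (by fun_prop) (hXm 0)]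
    rfl
  have hclt := tendstoInDistribution_inv_sqrt_mul_sum_sub (P := Q)
    (P' := gaussianReal 0 (projVariance r).toNNReal) (X := fun i ω => W (X i ω))
    (Y := fun x : ℝ => x) (by rw [hVar]; exact HasLaw.id) ((hX 0).memLp_comp hWL)
    (hindep.comp (fun _ => W) fun _ => hWm) (identDistrib_comp hX hWm)
  have hU := boundedInProbability_average_comp hX hindep (f := fun x => |x| ^ r / M)
    (by fun_prop) ((memLp_abs_rpow_gaussianReal hr.le).mul_const (M⁻¹))
  have hV := boundedInProbability_average_comp hX hindep (f := fun x => |x| ^ (2 : ℝ))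
    (by fun_prop) (memLp_abs_rpow_gaussianReal zero_le_two)
  rw [integral_div, hMr, div_self hMpos.ne'] at hU
  rw [integral_sq_gaussianReal] at hV
  have hdelta := BoundedInProbability.delta_method (Q := Q) (x₀ := ((1, 1) : ℝ × ℝ))
    (D := fun n ω => ((∑ k ∈ Finset.range n, |X k ω| ^ r / M) / n,
      (∑ k ∈ Finset.range n, |X k ω| ^ (2 : ℝ)) / n))
    (hU.prodMk hV) (hasFDerivAt_rpow_mul_inv_sqrt (1 / r))
  refine tendstoInDistribution_of_tendstoInMeasure_sub _ _ hclt ?_ fun n => ?_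
  · refine hdelta.congr (fun n => ae_of_all _ fun ω => ?_) (ae_of_all _ fun ω => rfl)
    simp only [Pi.sub_apply]
    rw [(hX 0).integral_fun_comp hWm, hEW]
    -- The derivative at the fluctuation vector is exactly the normalized sum in the central limit
    -- theorem.
    have hlin : ((1 / r) • ContinuousLinearMap.fst ℝ ℝ ℝ -
        (1 / 2 : ℝ) • ContinuousLinearMap.snd ℝ ℝ ℝ) (√(n : ℝ) •
          (((∑ k ∈ Finset.range n, |X k ω| ^ r / M) / n,
      (∑ k ∈ Finset.range n, |X k ω| ^ (2 : ℝ)) / n) - ((1, 1) : ℝ × ℝ))) =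
      (√(n : ℝ))⁻¹ * (∑ k ∈ Finset.range n, W (X k ω) - n * (1 / r - 1 / 2)) := by
      simp only [hW, Finset.sum_sub_distrib, ← Finset.sum_div]
      rcases Nat.eq_zero_or_pos n with rfl | hn
      · simp
      have hn' : (0 : ℝ) < n := by exact_mod_cast hn
      have hs : √(n : ℝ) * √(n : ℝ) = n := Real.mul_self_sqrt hn'.le
      simp only [sub_apply, smul_apply, Prod.mk_sub_mk,
        Prod.smul_mk, ContinuousLinearMap.coe_fst', ContinuousLinearMap.coe_snd', smul_eq_mul]
      rw [eq_inv_mul_iff_mul_eq₀ (by positivity)]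
      generalize √(n : ℝ) = t at hs
      rw [← hs]
      have : t ≠ 0 := by rintro rfl; simp at hs; linarith
      field_simp
      ring
    rw [hlin]
    simp
  · fun_prop

end GaussianSequence

/-! ### Gaussian tails -/

section Mills

theorem integrable_exp_neg_sq_half : Integrable fun x : ℝ => Real.exp (-x ^ 2 / 2) := by
  refine (integrable_exp_neg_mul_sq (b := 1 / 2) (by norm_num)).congr (ae_of_all _ fun x => ?_)
  simp only
  ring_nf

theorem tendsto_exp_neg_sq_half : Tendsto (fun x : ℝ => Real.exp (-x ^ 2 / 2)) atTop (𝓝 0) := by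
  refine Real.tendsto_exp_atBot.comp ?_
  simp only [neg_div]
  exact tendsto_neg_atTop_atBot.comp ((tendsto_pow_atTop two_ne_zero).atTop_div_const two_pos)

theorem hasDerivAt_exp_neg_sq_half (x : ℝ) :
    HasDerivAt (fun x : ℝ => Real.exp (-x ^ 2 / 2)) (-(x * Real.exp (-x ^ 2 / 2))) x := by
  have := ((((hasDerivAt_id x).pow 2).neg).div_const 2).exp
  convert! this using 1
  simp
  ring

/-- On (t, ∞) replace the factor t by x; then the integrand has an explicit antiderivative. -/
theorem integral_Ioi_exp_neg_sq_half_le {t : ℝ} (ht : 0 < t) :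
    t * ∫ x in Ioi t, Real.exp (-x ^ 2 / 2) ≤ Real.exp (-t ^ 2 / 2) := by
  have hd : ∀ x ∈ Ioi t, HasDerivAt (fun x : ℝ => -Real.exp (-x ^ 2 / 2))
      (x * Real.exp (-x ^ 2 / 2)) x := fun x _ => by
    simpa using (hasDerivAt_exp_neg_sq_half x).fun_neg
  have hlim : Tendsto (fun x : ℝ => -Real.exp (-x ^ 2 / 2)) atTop (𝓝 0) := by
    simpa using tendsto_exp_neg_sq_half.neg
  have hc : ContinuousWithinAt (fun x : ℝ => -Real.exp (-x ^ 2 / 2)) (Ici t) t :=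
    Continuous.continuousWithinAt (by fun_prop)
  have hint : IntegrableOn (fun x : ℝ => x * Real.exp (-x ^ 2 / 2)) (Ioi t) :=
    integrableOn_Ioi_deriv_of_nonneg hc hd (fun x hx => by
      have : 0 < x := ht.trans hx
      positivity) hlim
  have heq := integral_Ioi_of_hasDerivAt_of_tendsto hc hd hint hlim
  rw [← integral_const_mul, show Real.exp (-t ^ 2 / 2) = 0 - -Real.exp (-t ^ 2 / 2) by ring, ← heq]
  refine setIntegral_mono_on (integrable_exp_neg_sq_half.integrableOn.const_mul t) hint
    measurableSet_Ioi fun x hx => ?_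
  exact mul_le_mul_of_nonneg_right (le_of_lt hx) (Real.exp_pos _).le

/-- The function -x⁻¹ exp(-x²/2) has derivative (1 + x⁻²) exp(-x²/2), and 1 + x⁻² ≤ 1 + t⁻² on (t,
∞). -/
theorem le_integral_Ioi_exp_neg_sq_half {t : ℝ} (ht : 0 < t) :
    Real.exp (-t ^ 2 / 2) ≤ (t + t⁻¹) * ∫ x in Ioi t, Real.exp (-x ^ 2 / 2) := by
  have hd : ∀ x ∈ Ici t, HasDerivAt (fun x : ℝ => -(x⁻¹ * Real.exp (-x ^ 2 / 2)))
      ((1 + (x ^ 2)⁻¹) * Real.exp (-x ^ 2 / 2)) x := fun x hx => by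
    have hx0 : x ≠ 0 := (ht.trans_le hx).ne'
    convert! ((hasDerivAt_inv hx0).mul (hasDerivAt_exp_neg_sq_half x)).fun_neg using 1
    field_simp
    ring
  have hlim : Tendsto (fun x : ℝ => -(x⁻¹ * Real.exp (-x ^ 2 / 2))) atTop (𝓝 0) := by
    simpa using (tendsto_inv_atTop_zero.mul tendsto_exp_neg_sq_half).neg
  have hc : ContinuousWithinAt (fun x : ℝ => -(x⁻¹ * Real.exp (-x ^ 2 / 2))) (Ici t) t :=
    (hd t self_mem_Ici).continuousAt.continuousWithinAt
  have hd' := fun x (hx : x ∈ Ioi t) => hd x (Ioi_subset_Ici_self hx)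
  have hint : IntegrableOn (fun x : ℝ => (1 + (x ^ 2)⁻¹) * Real.exp (-x ^ 2 / 2)) (Ioi t) :=
    integrableOn_Ioi_deriv_of_nonneg hc hd' (fun x hx => by positivity) hlim
  have heq := integral_Ioi_of_hasDerivAt_of_tendsto hc hd' hint hlim
  have hle : t⁻¹ * Real.exp (-t ^ 2 / 2) ≤
      (1 + (t ^ 2)⁻¹) * ∫ x in Ioi t, Real.exp (-x ^ 2 / 2) := by
    rw [← integral_const_mul,
      show t⁻¹ * Real.exp (-t ^ 2 / 2) = 0 - -(t⁻¹ * Real.exp (-t ^ 2 / 2)) by ring, ← heq]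
    refine setIntegral_mono_on hint (integrable_exp_neg_sq_half.integrableOn.const_mul _)
      measurableSet_Ioi fun x (hx : t < x) => ?_
    gcongr
  calc Real.exp (-t ^ 2 / 2) = t * (t⁻¹ * Real.exp (-t ^ 2 / 2)) := by field_simp
    _ ≤ t * ((1 + (t ^ 2)⁻¹) * ∫ x in Ioi t, Real.exp (-x ^ 2 / 2)) := by gcongr
    _ = (t + t⁻¹) * ∫ x in Ioi t, Real.exp (-x ^ 2 / 2) := by field_simp

/-- The asymptotics of the Mills ratio. -/
theorem tendsto_mills :
    Tendsto (fun t : ℝ => t * Real.exp (t ^ 2 / 2) * ∫ x in Ioi t, Real.exp (-x ^ 2 / 2))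
      atTop (𝓝 1) := by
  have hexp : ∀ t : ℝ, Real.exp (t ^ 2 / 2) * Real.exp (-t ^ 2 / 2) = 1 := fun t => by
    rw [← Real.exp_add]; simp [neg_div]
  have hlow : Tendsto (fun t : ℝ => (1 + (t ^ 2)⁻¹)⁻¹) atTop (𝓝 1) := by
    have h : Tendsto (fun t : ℝ => (t ^ 2)⁻¹) atTop (𝓝 0) :=
      tendsto_inv_atTop_zero.comp (tendsto_pow_atTop two_ne_zero)
    simpa using (h.const_add 1).inv₀ (by norm_num)
  refine tendsto_of_tendsto_of_tendsto_of_le_of_le' hlow tendsto_const_nhds ?_ ?_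
  · filter_upwards [eventually_gt_atTop 0] with t ht
    have h := mul_le_mul_of_nonneg_left (le_integral_Ioi_exp_neg_sq_half ht)
      (Real.exp_pos (t ^ 2 / 2)).le
    rw [hexp] at h
    rw [inv_le_iff_one_le_mul₀ (by positivity)]
    refine h.trans_eq ?_
    field_simp
  · filter_upwards [eventually_gt_atTop 0] with t ht
    have h := mul_le_mul_of_nonneg_left (integral_Ioi_exp_neg_sq_half_le ht)
      (Real.exp_pos (t ^ 2 / 2)).le
    rw [hexp] at h
    refine le_trans (le_of_eq ?_) h
    ring

theorem measureReal_gaussianReal_lt_abs {t : ℝ} (ht : 0 ≤ t) :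
    (gaussianReal 0 1).real {x | t < |x|} =
      √(2 / Real.pi) * ∫ x in Ioi t, Real.exp (-x ^ 2 / 2) := by
  have hm : MeasurableSet {x : ℝ | t < |x|} := measurableSet_lt measurable_const (by fun_prop)
  rw [← integral_indicator_one hm, integral_gaussianReal_eq_integral_smul one_ne_zero]
  have h1 : ∀ x : ℝ, gaussianPDFReal 0 1 x • ({x : ℝ | t < |x|}.indicator (1 : ℝ → ℝ) x) =
      (√(2 * Real.pi))⁻¹ * (Ioi t).indicator (fun x => Real.exp (-x ^ 2 / 2)) |x| := by
    intro x
    by_cases h : t < |x|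
    · rw [indicator_of_mem (show x ∈ {x : ℝ | t < |x|} from h),
        indicator_of_mem (show |x| ∈ Ioi t from h), gaussianPDFReal, sq_abs]
      simp
    · rw [indicator_of_notMem (show x ∉ {x : ℝ | t < |x|} from h),
        indicator_of_notMem (show |x| ∉ Ioi t from h)]
      simp
  simp only [h1]
  rw [integral_const_mul,
    integral_comp_abs (f := fun y => (Ioi t).indicator (fun x => Real.exp (-x ^ 2 / 2)) y),
    setIntegral_indicator measurableSet_Ioi, inter_eq_self_of_subset_right (Ioi_subset_Ioi ht),
    Real.sqrt_div zero_le_two, Real.sqrt_mul zero_le_two]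
  have hpi := Real.pi_pos
  have h2 : √2 * √2 = (2 : ℝ) := Real.mul_self_sqrt zero_le_two
  field_simp
  rw [sq, h2]

theorem gumbelK_two : gumbelK 2 = √(2 / Real.pi) := by
  have hpi := Real.pi_pos
  rw [gumbelK, ← Real.sqrt_eq_rpow, add_comm, Real.Gamma_add_one (by norm_num),
    Real.Gamma_one_half_eq, Real.sqrt_div zero_le_two]
  have h2 : √2 * √2 = (2 : ℝ) := Real.mul_self_sqrt zero_le_two
  field_simp
  rw [sq, h2]

/-- With L = √(2 log n), so that n = exp(L²/2), the tail asymptotics can be taken in the real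
variable L. -/
theorem centeringA_two_eq {n : ℕ} (hn : 1 < n) :
    centeringA 2 n = √(2 * Real.log n) ^ 2 + Real.log (gumbelK 2) -
      Real.log √(2 * Real.log n) := by
  have hlog : 0 < Real.log n := Real.log_pos (by exact_mod_cast hn)
  rw [Real.sq_sqrt (by positivity), Real.log_sqrt (by positivity), centeringA]
  ring

theorem tendsto_log_div_self : Tendsto (fun x : ℝ => Real.log x / x) atTop (𝓝 0) := by
  simpa using Real.isLittleO_log_id_atTop.tendsto_div_nhds_zero

/-- The rescaled tail of `|g|`, for a standard Gaussian variable `g`, has an exponential limit. -/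
theorem tendsto_exp_sq_half_mul_tail (y : ℝ) :
    Tendsto (fun L : ℝ => Real.exp (L ^ 2 / 2) *
      (gaussianReal 0 1).real {x | (L ^ 2 + Real.log (gumbelK 2) - Real.log L + y) / L < |x|})
      atTop (𝓝 (Real.exp (-y))) := by
  set K := gumbelK 2 with hK
  have hKpos : 0 < K := by
    have := Real.pi_pos
    rw [hK, gumbelK_two]; positivity
  -- The threshold is t = L + d. In t²/2 the cross term L d equals y + log K - log L, which yields
  -- the factor e^{-y} and cancels K/t up to t/L → 1; d²/2 vanishes in the limit.
  set d : ℝ → ℝ := fun L => (y + Real.log K - Real.log L) / L with hd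
  have hd0 : Tendsto d atTop (𝓝 0) := by
    have h1 : Tendsto (fun L : ℝ => (y + Real.log K) / L) atTop (𝓝 0) :=
      tendsto_const_nhds.div_atTop tendsto_id
    simpa [hd, sub_div] using h1.sub tendsto_log_div_self
  set t : ℝ → ℝ := fun L => L + d L with ht
  have htt : Tendsto t atTop atTop := tendsto_id.atTop_add hd0
  have htL : Tendsto (fun L => t L / L) atTop (𝓝 1) := by
    have h1 : Tendsto (fun L : ℝ => 1 + d L / L) atTop (𝓝 (1 + 0)) :=
      (hd0.div_atTop tendsto_id).const_add 1
    rw [add_zero] at h1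
    refine h1.congr' ?_
    filter_upwards [eventually_gt_atTop 0] with L hL
    simp only [ht]
    field_simp
  have hexp : Tendsto (fun L => Real.exp (-(d L ^ 2 / 2))) atTop (𝓝 1) := by
    have h1 : Tendsto (fun L => -(d L ^ 2 / 2)) atTop (𝓝 (-(0 ^ 2 / 2))) :=
      ((hd0.pow 2).div_const 2).neg
    have := (Real.continuous_exp.tendsto _).comp h1
    simpa [Function.comp_def] using this
  have hmain : Tendsto (fun L => Real.exp (-y) * ((t L * Real.exp (t L ^ 2 / 2) *
      ∫ x in Ioi (t L), Real.exp (-x ^ 2 / 2)) * (t L / L)⁻¹ * Real.exp (-(d L ^ 2 / 2))))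
      atTop (𝓝 (Real.exp (-y))) := by
    simpa using (((tendsto_mills.comp htt).mul (htL.inv₀ one_ne_zero)).mul hexp).const_mul
      (Real.exp (-y))
  refine hmain.congr' ?_
  filter_upwards [eventually_gt_atTop 0, htt.eventually_gt_atTop 0] with L hL htL0
  have h1 : (L ^ 2 + Real.log K - Real.log L + y) / L = t L := by
    simp only [ht, hd]; field_simp; ring
  rw [h1, measureReal_gaussianReal_lt_abs htL0.le, ← gumbelK_two, ← hK]
  have h2 : t L ^ 2 / 2 = L ^ 2 / 2 + (y + Real.log K - Real.log L) + d L ^ 2 / 2 := by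
    simp only [ht, hd]; field_simp; ring
  have h3 : Real.exp (t L ^ 2 / 2) =
      Real.exp (L ^ 2 / 2) * (Real.exp y * K / L) * Real.exp (d L ^ 2 / 2) := by
    rw [h2, Real.exp_add, Real.exp_add, Real.exp_sub, Real.exp_add, Real.exp_log hKpos,
      Real.exp_log hL]
  rw [h3, Real.exp_neg, Real.exp_neg]
  have := htL0.ne'
  field_simp

end Mills

/-! ### q* = ∞: Gumbel limit of the maximum -/

section GaussianMaximum

variable {Ω : Type*} [MeasurableSpace Ω] {Q : Measure Ω} {X : ℕ → Ω → ℝ}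

theorem aemeasurable_norm_toLp {ι : Type*} [Fintype ι] (p : ℝ≥0∞) [Fact (1 ≤ p)] {f : Ω → ι → ℝ}
    (hf : AEMeasurable f Q) :
    AEMeasurable (fun ω => ‖(WithLp.toLp p (f ω) : PiLp p fun _ : ι => ℝ)‖) Q :=
  (Continuous.measurable (f := fun v : ι → ℝ => ‖(WithLp.toLp p v : PiLp p fun _ : ι => ℝ)‖)
    (by fun_prop)).comp_aemeasurable hf

theorem measureReal_gumbelMeasure_Iic (t : ℝ) :
    gumbelMeasure.real (Iic t) = Real.exp (-Real.exp (-t)) := by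
  have hlim : Tendsto gumbelCDF atBot (𝓝 0) := Real.tendsto_exp_neg_atTop_nhds_zero.comp
    (Real.tendsto_exp_atTop.comp tendsto_neg_atBot_atTop)
  rw [measureReal_def, gumbelMeasure, StieltjesFunction.measure_Iic _ hlim, sub_zero]
  exact ENNReal.toReal_ofReal (Real.exp_pos _).le

theorem measureReal_norm_top_le (hX : ∀ i, HasLaw (X i) (gaussianReal 0 1) Q)
    (hindep : iIndepFun X Q) {n : ℕ} (hn : 0 < n) (t : ℝ) :
    Q.real {ω | ‖(WithLp.toLp ∞ fun i : Fin n => X i ω : PiLp ∞ fun _ : Fin n => ℝ)‖ ≤ t} =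
      (1 - (gaussianReal 0 1).real {x | t < |x|}) ^ n := by
  have : Nonempty (Fin n) := ⟨⟨0, hn⟩⟩
  have hm : MeasurableSet {x : ℝ | |x| ≤ t} := measurableSet_le (by fun_prop) measurable_const
  have hset : {ω | ‖(WithLp.toLp ∞ fun i : Fin n => X i ω : PiLp ∞ fun _ : Fin n => ℝ)‖ ≤ t} =
      ⋂ i ∈ Finset.range n, X i ⁻¹' {x : ℝ | |x| ≤ t} := by
    ext ω
    rw [mem_ofPred_eq, PiLp.norm_eq_ciSup, ciSup_le_iff (finite_range _).bddAbove]
    simp only [Real.norm_eq_abs, mem_iInter, Finset.mem_range]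
    exact ⟨fun h i hi => h ⟨i, hi⟩, fun h i => h i i.2⟩
  have hcompl : {x : ℝ | t < |x|} = {x : ℝ | |x| ≤ t}ᶜ := by ext; simp
  rw [hset, measureReal_def, hindep.measure_inter_preimage_eq_mul _ fun _ _ => hm, hcompl,
    probReal_compl_eq_one_sub hm, sub_sub_cancel]
  have hp : ∀ i, Q (X i ⁻¹' {x : ℝ | |x| ≤ t}) = gaussianReal 0 1 {x : ℝ | |x| ≤ t} := fun i => by
    rw [← (hX i).map_eq, Measure.map_apply_of_aemeasurable (hX i).aemeasurable hm]
  simp only [hp, Finset.prod_const, Finset.card_range, ENNReal.toReal_pow, measureReal_def]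

variable [IsProbabilityMeasure Q]

/-- The maximum of `n` absolute values of independent standard Gaussian variables, suitably
normalized, converges to a Gumbel variable. -/
theorem tendstoInDistribution_norm_top (hX : ∀ i, HasLaw (X i) (gaussianReal 0 1) Q)
    (hindep : iIndepFun X Q) :
    TendstoInDistribution (fun (n : ℕ) ω => √(2 * Real.log n) *
        ‖(WithLp.toLp ∞ fun i : Fin n => X i ω : PiLp ∞ fun _ : Fin n => ℝ)‖ - centeringA 2 n)
      atTop (fun x : ℝ => x) (fun _ => Q) gumbelMeasure := by
  have hXm : ∀ i, AEMeasurable (X i) Q := fun i => (hX i).aemeasurable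
  have hmeas : ∀ n : ℕ, AEMeasurable (fun ω => √(2 * Real.log n) *
      ‖(WithLp.toLp ∞ fun i : Fin n => X i ω : PiLp ∞ fun _ : Fin n => ℝ)‖ - centeringA 2 n) Q :=
    fun n => ((aemeasurable_norm_toLp (ι := Fin n) ∞ (aemeasurable_pi_lambda _ fun i => hXm i)).const_mul
      _).sub_const _
  refine ⟨hmeas, by fun_prop, tendsto_probabilityMeasure_of_tendsto_measureReal_Iic fun y => ?_⟩
  simp only [ProbabilityMeasure.coe_mk, Measure.map_id']
  rw [measureReal_gumbelMeasure_Iic]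
  have hL : Tendsto (fun n : ℕ => √(2 * Real.log n)) atTop atTop :=
    Real.tendsto_sqrt_atTop.comp
      ((Real.tendsto_log_atTop.comp tendsto_natCast_atTop_atTop).const_mul_atTop two_pos)
  have hlim := (tendsto_exp_sq_half_mul_tail y).comp hL
  -- The distribution function of the maximum is (1 - p_n)^n with n p_n → e^{-y}.
  have hpow := Real.tendsto_one_add_pow_exp_of_tendsto (t := -Real.exp (-y)) (g := fun n : ℕ =>
    -(gaussianReal 0 1).real {x | (centeringA 2 n + y) / √(2 * Real.log n) < |x|}) (by
      simp only [mul_neg]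
      refine (hlim.congr' ?_).neg
      filter_upwards [eventually_gt_atTop 1] with n hn
      have hlog : 0 < Real.log n := Real.log_pos (by exact_mod_cast hn)
      have hn0 : (0 : ℝ) < n := by positivity
      rw [centeringA_two_eq hn]
      simp only [Function.comp_apply]
      congr 1
      rw [Real.sq_sqrt (by positivity), mul_div_cancel_left₀ _ two_ne_zero, Real.exp_log hn0])
  refine hpow.congr' ?_
  filter_upwards [eventually_gt_atTop 1, hL.eventually_gt_atTop 0] with n hn hLn
  rw [map_measureReal_apply_of_aemeasurable (hmeas n) measurableSet_Iic, ← sub_eq_add_neg,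
    ← measureReal_norm_top_le hX hindep (by lia)]
  congr 1
  ext ω
  simp only [mem_ofPred_eq, mem_preimage, mem_Iic]
  rw [le_div_iff₀ hLn, sub_le_iff_le_add, mul_comm, add_comm y]

theorem tendsto_centeringA_div_sqrt :
    Tendsto (fun n : ℕ => centeringA 2 n / √(n : ℝ)) atTop (𝓝 0) := by
  set c := Real.log (gumbelK 2)
  have hlog : Tendsto (fun n : ℕ => Real.log n / √(n : ℝ)) atTop (𝓝 0) := by
    have h := (isLittleO_log_rpow_atTop (r := 1 / 2) (by norm_num)).tendsto_div_nhds_zero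
    simpa only [Real.sqrt_eq_rpow, Function.comp_def] using h.comp tendsto_natCast_atTop_atTop
  have hbound : Tendsto (fun n : ℕ => 3 * (Real.log n / √(n : ℝ)) + |c| / √(n : ℝ)) atTop (𝓝 0) := by
    simpa using (hlog.const_mul 3).add (tendsto_const_nhds.div_atTop tendsto_sqrt_natCast)
  refine squeeze_zero_norm' ?_ hbound
  filter_upwards [eventually_gt_atTop 1, (Real.tendsto_log_atTop.comp
    tendsto_natCast_atTop_atTop).eventually_ge_atTop (1 : ℝ)] with n hn hlog1
  simp only [Function.comp_apply] at hlog1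
  have hs : 0 < √(n : ℝ) := Real.sqrt_pos.2 (by positivity)
  have h1 : 0 ≤ Real.log (2 * Real.log n) := Real.log_nonneg (by linarith)
  have h2 : Real.log (2 * Real.log n) ≤ 2 * Real.log n :=
    (Real.log_le_sub_one_of_pos (by linarith)).trans (by linarith)
  have h3 : |centeringA 2 n| ≤ 3 * Real.log n + |c| := by
    have := abs_le.1 (le_refl |c|)
    rw [centeringA, abs_le]
    constructor <;> linarith
  rw [Real.norm_eq_abs, abs_div, abs_of_pos hs, ← mul_div_assoc, ← add_div]
  gcongr

/-- With L = √(2 log n), m the maximum and w = V^{-1/2}, write L m w - A = (L m - A) w + A (w - 1):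
Slutsky handles the product, and the last term tends to 0 in probability. -/
theorem tendstoInDistribution_norm_top_div (hX : ∀ i, HasLaw (X i) (gaussianReal 0 1) Q)
    (hindep : iIndepFun X Q) :
    TendstoInDistribution (fun (n : ℕ) ω => 2 * (√(2 * Real.log n) *
        ‖(WithLp.toLp ∞ fun i : Fin n => X i ω : PiLp ∞ fun _ : Fin n => ℝ)‖ *
          (√((∑ k ∈ Finset.range n, |X k ω| ^ (2 : ℝ)) / n))⁻¹ - centeringA 2 n))
      atTop (fun x : ℝ => 2 * x) (fun _ => Q) gumbelMeasure := by
  have hXm : ∀ i, AEMeasurable (X i) Q := fun i => (hX i).aemeasurable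
  have hV := boundedInProbability_average_comp hX hindep (f := fun x => |x| ^ (2 : ℝ))
    (by fun_prop) (memLp_abs_rpow_gaussianReal zero_le_two)
  rw [integral_sq_gaussianReal] at hV
  set V : ℕ → Ω → ℝ := fun n ω => (∑ k ∈ Finset.range n, |X k ω| ^ (2 : ℝ)) / n with hVdef
  have hVm : ∀ n, AEMeasurable (V n) Q := fun n => by fun_prop
  have hder : HasFDerivAt (fun v : ℝ => (√v)⁻¹) _ 1 :=
    ((Real.hasDerivAt_sqrt one_ne_zero).fun_inv (by simp)).hasFDerivAt
  have hA := hV.tendstoInMeasure_mul_sub hder tendsto_centeringA_div_sqrt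
  have h1 := hV.tendstoInMeasure_mul_sub hder (a := fun _ => 1)
    (tendsto_const_nhds.div_atTop tendsto_sqrt_natCast)
  have h1' : TendstoInMeasure Q (fun n ω => (√(V n ω))⁻¹) atTop (fun _ => 1) := by
    rw [tendstoInMeasure_iff_norm] at h1 ⊢
    simpa only [one_mul, Real.sqrt_one, inv_one, Pi.zero_apply, sub_zero] using h1
  have hZ := (tendstoInDistribution_norm_top hX hindep).continuous_comp_prodMk_of_tendstoInMeasure_const
    (g := fun p : ℝ × ℝ => p.1 * p.2) (by fun_prop) h1' (fun n => by fun_prop)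
  have hZA := (hZ.add_of_tendstoInMeasure_const (c := 0) hA (fun n => by fun_prop)).continuous_comp
    (g := fun x : ℝ => 2 * x) (by fun_prop)
  refine hZA.congr (fun n => ae_of_all _ fun ω => ?_) (ae_of_all _ fun x => ?_)
  · simp only [Function.comp_apply, Pi.add_apply, Real.sqrt_one, inv_one]
    ring
  · simp

end GaussianMaximum

/-! ### Transfer to the sphere and conclusion -/

theorem norm_toLp_two_eq (n : ℕ) (x : ℕ → ℝ) :
    ‖WithLp.toLp 2 fun i : Fin n => x i‖ = √(∑ k ∈ Finset.range n, |x k| ^ (2 : ℝ)) := by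
  rw [EuclideanSpace.norm_eq, ← Fin.sum_univ_eq_sum_range fun k => |x k| ^ (2 : ℝ)]
  simp

theorem norm_toLp_eq {p : ℝ≥0∞} (hp : 0 < p.toReal) (n : ℕ) (x : ℕ → ℝ) :
    ‖(WithLp.toLp p fun i : Fin n => x i : PiLp p fun _ : Fin n => ℝ)‖ =
      (∑ k ∈ Finset.range n, |x k| ^ p.toReal) ^ (1 / p.toReal) := by
  rw [PiLp.norm_eq_sum hp, ← Fin.sum_univ_eq_sum_range fun k => |x k| ^ p.toReal]
  simp

theorem norm_toLp_smul {ι : Type*} [Fintype ι] (p : ℝ≥0∞) [Fact (1 ≤ p)] {c : ℝ} (hc : 0 ≤ c)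
    (v : EuclideanSpace ℝ ι) :
    ‖(WithLp.toLp p (c • v).ofLp : PiLp p fun _ : ι => ℝ)‖ =
      c * ‖(WithLp.toLp p v.ofLp : PiLp p fun _ : ι => ℝ)‖ := by
  rw [WithLp.ofLp_smul, WithLp.toLp_smul, norm_smul, Real.norm_of_nonneg hc]

theorem measurable_norm_toLp {ι : Type*} [Fintype ι] (p : ℝ≥0∞) [Fact (1 ≤ p)] :
    Measurable fun v : EuclideanSpace ℝ ι => ‖(WithLp.toLp p v.ofLp : PiLp p fun _ : ι => ℝ)‖ :=
  Continuous.measurable (by fun_prop)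

theorem MeasureTheory.TendstoInDistribution.comp_pnat {Ω Ω' : Type*} [MeasurableSpace Ω]
    [MeasurableSpace Ω'] {Q : Measure Ω} [IsProbabilityMeasure Q] {μ : Measure Ω'}
    [IsProbabilityMeasure μ] {Y : ℕ → Ω → ℝ} {Z : Ω' → ℝ}
    (h : TendstoInDistribution Y atTop Z (fun _ => Q) μ) :
    TendstoInDistribution (fun n : ℕ+ => Y n) atTop Z (fun _ => Q) μ :=
  ⟨fun n => h.forall_aemeasurable n, h.aemeasurable_limit,
    h.tendsto.comp tendsto_PNat_val_atTop_atTop⟩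

/-- Split n^{1-s} = √n · √n · n^{-s}: n^{-s} turns S into a mean, one √n does so for T, and the
other is the scale of the central limit theorem. -/
theorem rpow_mul_ratio_eq {n S T M s : ℝ} (hn : 0 < n) (hS : 0 ≤ S) (hT : 0 ≤ T) (hM : 0 < M) :
    n ^ (1 - s) * (2 * ((√T)⁻¹ * S ^ s)) / (2 * M ^ s) - √n =
      √n * ((S / M / n) ^ s * (√(T / n))⁻¹ - 1) := by
  have hns : 0 < n ^ s := Real.rpow_pos_of_pos hn s
  have hMs : 0 < M ^ s := Real.rpow_pos_of_pos hM s
  have hsq : √n * √n = n := Real.mul_self_sqrt hn.le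
  have hsn : 0 < √n := Real.sqrt_pos.2 hn
  rw [Real.rpow_sub hn, Real.rpow_one, Real.div_rpow (by positivity) hn.le,
    Real.div_rpow hS hM.le, Real.sqrt_div hT, inv_div]
  nth_rewrite 1 [← hsq]
  field_simp

theorem sqrt_mul_max_ratio_eq {n l T m a : ℝ} (hn : 0 < n) (hT : 0 ≤ T) :
    √(2 * n * l) * (2 * ((√T)⁻¹ * m)) - 2 * a = 2 * (√(2 * l) * m * (√(T / n))⁻¹ - a) := by
  rw [show 2 * n * l = n * (2 * l) by ring, Real.sqrt_mul hn.le, Real.sqrt_div hT, inv_div]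
  ring

theorem projVariance_nonneg {r : ℝ} (hr : 0 < r) : 0 ≤ projVariance r :=
  variance_linearization hr ▸ variance_nonneg _ _

/-- Transfer of a limit theorem for functions of a normalized Gaussian vector to the sphere. -/
theorem tendstoInDistribution_projLength {Ω : ℕ+ → Type*} [∀ n, MeasurableSpace (Ω n)]
    {P : ∀ n, Measure (Ω n)} [∀ n, IsProbabilityMeasure (P n)]
    {θ : ∀ n : ℕ+, Ω n → Metric.sphere (0 : EuclideanSpace ℝ (Fin (n : ℕ))) 1}
    (hθ : ∀ n : ℕ+, HasLaw (θ n) (uniformSphere (n : ℕ)) (P n))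
    {Ω₀ : Type*} [MeasurableSpace Ω₀] {Q : Measure Ω₀} [IsProbabilityMeasure Q] {X : ℕ → Ω₀ → ℝ}
    (hX : ∀ i, HasLaw (X i) (gaussianReal 0 1) Q) (hindep : iIndepFun X Q)
    {q qs : ℝ≥0∞} [Fact (1 ≤ q)] [Fact (1 ≤ qs)] (hq : q⁻¹ + qs⁻¹ = 1)
    {Ω' : Type*} [MeasurableSpace Ω'] {μ : Measure Ω'} [IsProbabilityMeasure μ] {Z : Ω' → ℝ}
    {g : ℕ+ → ℝ → ℝ} (hg : ∀ n, Measurable (g n)) {Y : ℕ → Ω₀ → ℝ}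
    (hY : TendstoInDistribution Y atTop Z (fun _ => Q) μ)
    (hgY : ∀ (n : ℕ+) ω, g n (2 * ((√(∑ k ∈ Finset.range n, |X k ω| ^ (2 : ℝ)))⁻¹ *
      ‖(WithLp.toLp qs fun i : Fin n => X i ω : PiLp qs fun _ : Fin n => ℝ)‖)) = Y n ω) :
    TendstoInDistribution (fun (n : ℕ+) ω =>
      g n (projLength (θ n ω : EuclideanSpace ℝ (Fin (n : ℕ))) (lqBall (n : ℕ) q))) atTop Z P μ := by
  have hF : ∀ n : ℕ+, Measurable fun v : EuclideanSpace ℝ (Fin (n : ℕ)) =>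
      g n (2 * ‖(WithLp.toLp qs v.ofLp : PiLp qs fun _ : Fin (n : ℕ) => ℝ)‖) := fun n =>
    (hg n).comp ((measurable_norm_toLp qs).const_mul 2)
  have hproj : ∀ (n : ℕ+) ω, projLength (θ n ω : EuclideanSpace ℝ (Fin (n : ℕ)))
      (lqBall (n : ℕ) q) = 2 * ‖(WithLp.toLp qs (θ n ω : EuclideanSpace ℝ (Fin (n : ℕ))).ofLp :
        PiLp qs fun _ : Fin (n : ℕ) => ℝ)‖ := fun n ω =>
    projLength_lqBall hq _ (mem_sphere_zero_iff_norm.1 (θ n ω).2)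
  simp only [hproj]
  refine hY.comp_pnat.of_map_eq (fun n => ?_) fun n => ?_
  · exact ((hF n).comp measurable_subtype_coe).comp_aemeasurable (hθ n).aemeasurable
  · rw [map_comp_uniformSphere_eq hX hindep (hθ n) (hF n)]
    congr 1
    ext ω
    rw [norm_toLp_smul qs (by positivity), norm_toLp_two_eq n fun i => X i ω]
    exact hgY n ω

theorem corollary2p3 {Ω : ℕ+ → Type*} [∀ n, MeasurableSpace (Ω n)]
    (P : ∀ n, Measure (Ω n)) [∀ n, IsProbabilityMeasure (P n)]
    (θ : ∀ n : ℕ+, Ω n → Metric.sphere (0 : EuclideanSpace ℝ (Fin (n : ℕ))) 1)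
    (hθ : ∀ n : ℕ+, HasLaw (θ n) (uniformSphere (n : ℕ)) (P n)) :
    (∀ q qs : ℝ≥0∞, 1 < q → q ≠ 2 → q⁻¹ + qs⁻¹ = 1 →
      0 ≤ projVariance qs.toReal ∧
      TendstoInDistribution
        (fun (n : ℕ+) (ω : Ω n) =>
          ((n : ℕ) : ℝ) ^ (q⁻¹).toReal *
              projLength (θ n ω : EuclideanSpace ℝ (Fin (n : ℕ))) (lqBall (n : ℕ) q) /
            (2 * momentM 2 qs.toReal ^ (1 / qs.toReal)) - √((n : ℕ) : ℝ))
        atTop (fun x : ℝ => x) P (gaussianReal 0 (projVariance qs.toReal).toNNReal)) ∧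
    TendstoInDistribution
      (fun (n : ℕ+) (ω : Ω n) =>
        √(2 * ((n : ℕ) : ℝ) * Real.log ((n : ℕ) : ℝ)) *
            projLength (θ n ω : EuclideanSpace ℝ (Fin (n : ℕ))) (lqBall (n : ℕ) 1) -
          2 * centeringA 2 (n : ℕ))
      atTop (fun x : ℝ => 2 * x) P gumbelMeasure := by
  obtain ⟨Ω₀, mΩ₀, Q, X, -, hX, hindep, hQ⟩ := exists_iid ℕ (gaussianReal 0 1)
  constructor
  · intro q qs hq1 _ hq
    have hc : q.HolderConjugate qs := ENNReal.holderConjugate_iff.2 hq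
    have hqs1 : 1 ≤ qs := ENNReal.HolderConjugate.one_le qs q
    have hqst : qs ≠ ∞ :=
      ((ENNReal.HolderConjugate.lt_top_iff_one_lt qs q).2 hq1).ne
    have : Fact (1 ≤ q) := ⟨hq1.le⟩
    have : Fact (1 ≤ qs) := ⟨hqs1⟩
    have hr : 0 < qs.toReal := ENNReal.toReal_pos (zero_lt_one.trans_le hqs1).ne' hqst
    have hM : 0 < momentM 2 qs.toReal := momentM_two_pos (by linarith)
    have hexp : (q⁻¹).toReal = 1 - 1 / qs.toReal := by
      have h := congrArg ENNReal.toReal hq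
      rw [ENNReal.toReal_add (ENNReal.inv_ne_top.2 (zero_lt_one.trans hq1).ne')
        (ENNReal.inv_ne_top.2 (zero_lt_one.trans_le hqs1).ne'), ENNReal.toReal_inv qs,
        ENNReal.toReal_one] at h
      rw [one_div]
      linarith
    refine ⟨projVariance_nonneg hr, ?_⟩
    refine tendstoInDistribution_projLength hθ hX hindep hq
      (g := fun n x => ((n : ℕ) : ℝ) ^ (q⁻¹).toReal * x /
        (2 * momentM 2 qs.toReal ^ (1 / qs.toReal)) - √((n : ℕ) : ℝ)) (fun n => by fun_prop)
      (tendstoInDistribution_ratio hX hindep hr) fun n ω => ?_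
    rw [norm_toLp_eq hr n fun i => X i ω, hexp, ← Finset.sum_div]
    exact rpow_mul_ratio_eq (by exact_mod_cast n.pos) (by positivity) (by positivity) hM
  · refine tendstoInDistribution_projLength hθ hX hindep (q := 1) (qs := ∞) (by simp)
      (g := fun n x => √(2 * ((n : ℕ) : ℝ) * Real.log ((n : ℕ) : ℝ)) * x - 2 * centeringA 2 n)
      (fun n => by fun_prop) (tendstoInDistribution_norm_top_div hX hindep) fun n ω => ?_
    exact sqrt_mul_max_ratio_eq (by exact_mod_cast n.pos) (by positivity)
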